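/- Let $(X,\mathcal B,\mu)$ be a standard Borel space with a non-atomic probability measure, and let $\mathrm{Aut}$ be the group of its invertible measure-preserving transformations, where transformations that agree $\mu$-almost everywhere are identified. Equip $\mathrm{Aut}$ with the Halmos metric $$\rho(S,T)=\sum_{i\ge 0} 2^{-i}\bigl(\mu(SA_i\,\triangle\, TA_i)+\mu(S^{-1}A_i\,\triangle\, T^{-1}A_i)\bigr),$$ where $(A_i)_{i\ge 0}$ is any sequence of measurable sets that is dense in $\mathcal B$ for the distance $\mu(A\triangle B)$. A set of transformations is called typical if it contains a dense $G_\delta$ subset of $(\mathrm{Aut},\rho)$. Say that $T\in\mathrm{Aut}$ has property $(*)$ if there are sequences of natural numbers $m_i\to\infty$ and $n_i\to\infty$ (which may depend on $T$) such that for every measurable set $A$ $$\mu(A\cap T^{m_i}A\cap T^{n_i}A)\to \frac{\mu(A)+2\mu(A)^3}{3},\qquad \mu(A\cap T^{-m_i}A\cap T^{-n_i}A)\to \mu(A)^2 .$$ Then: 1. every $T\in\mathrm{Aut}$ with property $(*)$ is asymmetric, that is, $T$ and $T^{-1}$ are not conjugate in $\mathrm{Aut}$; 2. for every such sequence $(A_i)$,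 the set of $T\in\mathrm{Aut}$ with property $(*)$ is typical. -/

import Mathlib

open MeasureTheory Filter Topology
open scoped symmDiff

/-- The group of everywhere defined invertible bimeasurable transformations of `X` that
preserve `μ`; multiplication is composition. -/
def mpGroup {X : Type*} [MeasurableSpace X] (μ : Measure X) : Subgroup (Equiv.Perm X) where
  carrier := {T | MeasurePreserving T μ μ ∧ MeasurePreserving T.symm μ μ}
  mul_mem' := fun hS hT => ⟨hS.1.comp hT.1, hT.2.comp hS.2⟩
  one_mem' := ⟨MeasurePreserving.id μ, MeasurePreserving.id μ⟩
  inv_mem' := fun hT => ⟨hT.2, hT.1⟩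

/-- The transformations that coincide with the identity almost everywhere. -/
def aeTrivial {X : Type*} [MeasurableSpace X] (μ : Measure X) : Subgroup (mpGroup μ) where
  carrier := {T | ∀ᵐ x ∂μ, (T : Equiv.Perm X) x = x}
  mul_mem' := by
    intro S T hS hT
    change ∀ᵐ x ∂μ, ((S * T : mpGroup μ) : Equiv.Perm X) x = x
    filter_upwards [hS, hT] with x h1 h2
    have h : ((S * T : mpGroup μ) : Equiv.Perm X) x
        = (S : Equiv.Perm X) ((T : Equiv.Perm X) x) := rfl
    rw [h, h2, h1]
  one_mem' := by
    change ∀ᵐ x ∂μ, ((1 : mpGroup μ) : Equiv.Perm X) x = x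
    exact Eventually.of_forall fun _ => rfl
  inv_mem' := by
    intro T hT
    change ∀ᵐ x ∂μ, ((T⁻¹ : mpGroup μ) : Equiv.Perm X) x = x
    filter_upwards [hT] with x h
    exact (Equiv.symm_apply_eq (T : Equiv.Perm X)).2 h.symm

instance aeTrivial_normal {X : Type*} [MeasurableSpace X] (μ : Measure X) :
    (aeTrivial μ).Normal where
  conj_mem := by
    intro T hT S
    have h := S.2.2.quasiMeasurePreserving.ae hT
    change ∀ᵐ x ∂μ, ((S * T * S⁻¹ : mpGroup μ) : Equiv.Perm X) x = x
    filter_upwards [h] with x hx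
    have h1 : ((S * T * S⁻¹ : mpGroup μ) : Equiv.Perm X) x
        = (S : Equiv.Perm X) ((T : Equiv.Perm X) ((S : Equiv.Perm X).symm x)) := rfl
    rw [h1, hx, Equiv.apply_symm_apply]

/-- The group `Aut(X, μ)` of automorphisms of the measure space: invertible measure preserving
transformations, two of them being identified when they coincide almost everywhere. -/
abbrev MeasureAut {X : Type*} [MeasurableSpace X] (μ : Measure X) : Type _ :=
  mpGroup μ ⧸ aeTrivial μ

namespace MeasureAut

variable {X : Type*} [MeasurableSpace X] {μ : Measure X}

/-- The image `T A` of a set under an automorphism. It is computed with a chosen representative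
of `T`, hence is meaningful up to a null set; see `image_mk`. -/
noncomputable def image (T : MeasureAut μ) (A : Set X) : Set X :=
  ((Quotient.out T : mpGroup μ) : Equiv.Perm X) '' A

/-- Up to a null set, `image` may be computed with any representative. -/
theorem image_mk (S : mpGroup μ) (A : Set X) :
    image (QuotientGroup.mk S : MeasureAut μ) A =ᵐ[μ] (S : Equiv.Perm X) '' A := by
  obtain ⟨N, hN⟩ := QuotientGroup.mk_out_eq_mul (aeTrivial μ) S
  have hN' : ∀ᵐ x ∂μ, ((N⁻¹ : aeTrivial μ) : mpGroup μ).1 x = x := (N⁻¹).2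
  have h := S.2.2.quasiMeasurePreserving.ae hN'
  have e : image (QuotientGroup.mk S : MeasureAut μ) A
      = ((S * N : mpGroup μ) : Equiv.Perm X) '' A := by
    rw [← hN]; rfl
  rw [e]
  filter_upwards [h] with x hx
  have hx' : ((N : mpGroup μ) : Equiv.Perm X).symm ((S : Equiv.Perm X).symm x)
      = (S : Equiv.Perm X).symm x := hx
  apply propext
  change x ∈ ((S * N : mpGroup μ) : Equiv.Perm X) '' A ↔ x ∈ (S : Equiv.Perm X) '' A
  rw [Equiv.image_eq_preimage_symm, Equiv.image_eq_preimage_symm]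
  change ((N : mpGroup μ) : Equiv.Perm X).symm ((S : Equiv.Perm X).symm x) ∈ A ↔
    (S : Equiv.Perm X).symm x ∈ A
  rw [hx']

/-- `T` is asymmetric if it is not conjugate to its inverse in `Aut(X, μ)`. -/
def IsAsymmetric (T : MeasureAut μ) : Prop := ¬ IsConj T T⁻¹

/-- The asymmetric double limit property: for some `m i, n i → ∞` and all measurable `A`,
`μ(A ∩ T^{m i} A ∩ T^{n i} A) → (μ(A) + 2 μ(A)^3) / 3` and
`μ(A ∩ T^{-m i} A ∩ T^{-n i} A) → μ(A)^2`. -/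
def HasAsymmetricLimits (T : MeasureAut μ) : Prop :=
  ∃ m n : ℕ → ℕ, Tendsto m atTop atTop ∧ Tendsto n atTop atTop ∧
    ∀ A : Set X, MeasurableSet A →
      Tendsto (fun i => μ.real (A ∩ image (T ^ (m i : ℤ)) A ∩ image (T ^ (n i : ℤ)) A)) atTop
        (𝓝 ((μ.real A + 2 * μ.real A ^ 3) / 3)) ∧
      Tendsto (fun i => μ.real (A ∩ image (T ^ (-(m i : ℤ))) A ∩ image (T ^ (-(n i : ℤ))) A)) atTop
        (𝓝 (μ.real A ^ 2))

end MeasureAut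

/-- The sequence of measurable sets `A i` is dense in the sigma-algebra of `X` with respect to
the distance `μ(A ∆ B)`. -/
def IsDenseSetSeq {X : Type*} [MeasurableSpace X] (μ : Measure X) (A : ℕ → Set X) : Prop :=
  (∀ i, MeasurableSet (A i)) ∧
    ∀ B : Set X, MeasurableSet B → ∀ ε : ℝ, 0 < ε → ∃ i, μ.real (A i ∆ B) < ε

namespace MeasureAut

variable {X : Type*} [MeasurableSpace X] {μ : Measure X}

/-- The `i`-th term `μ(S A_i ∆ T A_i) + μ(S⁻¹ A_i ∆ T⁻¹ A_i)` of the Halmos metric. -/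
noncomputable def halmosTerm (A : ℕ → Set X) (S T : MeasureAut μ) (i : ℕ) : ℝ :=
  μ.real (image S (A i) ∆ image T (A i)) + μ.real (image S⁻¹ (A i) ∆ image T⁻¹ (A i))

/-- The Halmos metric of a sequence of sets, with the weights `2^{-i}` that make the series
converge. -/
noncomputable def halmosDist (A : ℕ → Set X) (S T : MeasureAut μ) : ℝ :=
  ∑' i : ℕ, (1 / 2 : ℝ) ^ i * halmosTerm A S T i

theorem halmosTerm_nonneg (A : ℕ → Set X) (S T : MeasureAut μ) (i : ℕ) :
    0 ≤ halmosTerm A S T i := add_nonneg measureReal_nonneg measureReal_nonneg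

theorem summable_halmos [IsProbabilityMeasure μ] (A : ℕ → Set X) (S T : MeasureAut μ) :
    Summable fun i : ℕ => (1 / 2 : ℝ) ^ i * halmosTerm A S T i := by
  refine Summable.of_nonneg_of_le
    (fun i => mul_nonneg (by positivity) (halmosTerm_nonneg A S T i)) (fun i => ?_)
    (summable_geometric_two.mul_right 2)
  refine mul_le_mul_of_nonneg_left ?_ (by positivity)
  have h1 : μ.real (image S (A i) ∆ image T (A i)) ≤ 1 := measureReal_le_one
  have h2 : μ.real (image S⁻¹ (A i) ∆ image T⁻¹ (A i)) ≤ 1 := measureReal_le_one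
  unfold halmosTerm
  linarith

theorem measurableSet_image (T : MeasureAut μ) {A : Set X} (hA : MeasurableSet A) :
    MeasurableSet (image T A) := by
  unfold image
  rw [Equiv.image_eq_preimage_symm]
  exact (Quotient.out T : mpGroup μ).2.2.measurable hA

/-- `Aut(X, μ)` with the Halmos metric (it separates points when `X` is standard Borel and
the sequence is dense). -/
@[reducible]
noncomputable def halmosPseudoMetric (μ : Measure X) [IsProbabilityMeasure μ] (A : ℕ → Set X) :
    PseudoMetricSpace (MeasureAut μ) where
  dist := halmosDist A
  dist_self S := by simp [halmosDist, halmosTerm]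
  dist_comm S T := by
    simp only [halmosDist, halmosTerm, symmDiff_comm]
  dist_triangle S T U := by
    unfold halmosDist
    rw [← (summable_halmos A S T).tsum_add (summable_halmos A T U)]
    refine (summable_halmos A S U).tsum_le_tsum (fun i => ?_)
      ((summable_halmos A S T).add (summable_halmos A T U))
    rw [← mul_add]
    refine mul_le_mul_of_nonneg_left ?_ (by positivity)
    have h1 := measureReal_symmDiff_le (μ := μ) (s := image S (A i)) (t := image T (A i))
      (image U (A i))
    have h2 := measureReal_symmDiff_le (μ := μ) (s := image S⁻¹ (A i)) (t := image T⁻¹ (A i))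
      (image U⁻¹ (A i))
    unfold halmosTerm
    linarith

/-- A set of automorphisms is typical (generic) if it contains a dense `G_δ` set of
`Aut(X, μ)` with the Halmos metric of the sequence `A`. -/
def IsTypical [IsProbabilityMeasure μ] (A : ℕ → Set X) (P : Set (MeasureAut μ)) : Prop :=
  letI := halmosPseudoMetric μ A
  ∃ W : Set (MeasureAut μ), IsGδ W ∧ Dense W ∧ W ⊆ P

end MeasureAut

/-!
Asymmetry: a conjugation of `T` to `T⁻¹` would carry the limits of the forward triple correlations
to those of the backward ones, which differ for a set of measure `1 / 3`.

Typicality is a Baire category argument. By continuity of triple correlations in the Halmos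
topology, the automorphisms that realize the two limits approximately on finitely many sets at some
late pair of times form an open set. It is dense because every `S` is close to an automorphism that
has the limits exactly on finitely many given sets at the times `m` and `5 * m`. Such an
automorphism is an odometer on a cycle of twelve windows of length `m`, each coloured by one of four
independent random points; inside a window one follows the `S`-orbit of the point of its colour, so
that the odometer step agrees with `S` except where a window begins. A triple correlation at times
that are multiples of `m` then depends only on how many colours occur among three windows. Finally
the model is transported to the given space by an isomorphism that matches the finitely many sets.
-/

section NonatomicIsomorphism

open Set ProbabilityTheory

theorem not_countable_of_nullSingletonClass {X : Type*} [MeasurableSpace X] (μ : Measure X)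
    [IsProbabilityMeasure μ] [NullSingletonClass μ] : ¬ Countable X := fun _ =>
  IsProbabilityMeasure.ne_zero μ (Measure.measure_univ_eq_zero.1 (countable_univ.measure_zero μ))

theorem exists_not_countable_measure_eq_zero {X : Type*} [MeasurableSpace X]
    [StandardBorelSpace X] (hX : ¬ Countable X) (μ : Measure X) [SFinite μ] :
    ∃ N : Set X, MeasurableSet N ∧ ¬ N.Countable ∧ μ N = 0 := by
  have hR : ¬ Countable (ℝ × ℝ) := fun _ =>
    not_countable (α := ℝ) (Prod.mk_right_injective (0 : ℝ)).countable
  let e : X ≃ᵐ ℝ × ℝ := PolishSpace.measurableEquivOfNotCountable hX hR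
  let fibre : ℝ → Set X := fun x => {z | (e z).1 = x}
  have hmeas : ∀ x, MeasurableSet (fibre x) := fun x =>
    (measurable_fst.comp e.measurable) (measurableSet_singleton x)
  have hdisj : Pairwise (Function.onFun Disjoint fibre) := fun x y hxy =>
    Set.disjoint_left.2 fun z hzx hzy => hxy (hzx.symm.trans hzy)
  obtain ⟨x, hx⟩ : ∃ x, μ (fibre x) = 0 := by
    by_contra! hpos
    refine not_countable (α := ℝ) (countable_univ_iff.1 ?_)
    simpa only [pos_iff_ne_zero, hpos, ne_eq, not_false_eq_true, ofPred_true] using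
      Measure.countable_meas_pos_of_disjoint_iUnion (μ := μ) hmeas hdisj
  refine ⟨fibre x, hmeas x, fun hcount => ?_, hx⟩
  have hinj : Function.Injective fun y : ℝ => e.symm (x, y) := fun a b hab => by simpa using hab
  have hsub : (fun y : ℝ => e.symm (x, y)) '' univ ⊆ fibre x := by
    rintro _ ⟨y, -, rfl⟩
    simp [fibre]
  exact not_countable (α := ℝ) (countable_univ_iff.1
    (countable_of_injective_of_countable_image hinj.injOn (hcount.mono hsub)))

theorem exists_measurableEquiv_eqOn {X Y : Type*} [MeasurableSpace X] [StandardBorelSpace X]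
    [MeasurableSpace Y] [StandardBorelSpace Y] {T : X → Y} (hT : Measurable T) {s : Set X}
    (hs : MeasurableSet s) (hinj : InjOn T s) (hsc : ¬ sᶜ.Countable)
    (htc : ¬ (T '' s)ᶜ.Countable) : ∃ θ : X ≃ᵐ Y, EqOn θ T s := by
  classical
  have := hs.standardBorel
  have hemb : MeasurableEmbedding (s.domRestrict T) :=
    (hT.comp measurable_subtype_coe).measurableEmbedding hinj.injective
  have := hs.compl.standardBorel
  have := hemb.measurableSet_range.compl.standardBorel
  rw [← range_domRestrict] at htc
  let onCompl : (sᶜ : Set X) ≃ᵐ ((range (s.domRestrict T))ᶜ : Set Y) :=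
    PolishSpace.measurableEquivOfNotCountable hsc htc
  refine ⟨(MeasurableEquiv.sumCompl hs).symm.trans
    ((MeasurableEquiv.sumCongr hemb.equivRange onCompl).trans
      (MeasurableEquiv.sumCompl hemb.measurableSet_range)), fun x hx => ?_⟩
  have hinl : (MeasurableEquiv.sumCompl hs).symm x = Sum.inl ⟨x, hx⟩ :=
    Equiv.Set.sumCompl_symm_apply_of_mem hx
  simp only [MeasurableEquiv.coe_trans, Function.comp_apply, hinl]
  exact congrArg Subtype.val (hemb.equivRange_apply ⟨x, hx⟩)

theorem exists_measurableEquiv_ae_eq {X Y : Type*} [MeasurableSpace X] [StandardBorelSpace X]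
    [MeasurableSpace Y] [StandardBorelSpace Y] {μ : Measure X} {ν : Measure Y}
    [IsProbabilityMeasure μ] [IsProbabilityMeasure ν] [NullSingletonClass μ]
    [NullSingletonClass ν] {T : X → Y} (hT : MeasurePreserving T μ ν) {s : Set X}
    (hs : ∀ᵐ x ∂μ, x ∈ s) (hinj : InjOn T s) :
    ∃ θ : X ≃ᵐ Y, MeasurePreserving θ μ ν ∧ θ =ᵐ[μ] T := by
  obtain ⟨N, hNm, hNc, hN0⟩ :=
    exists_not_countable_measure_eq_zero (not_countable_of_nullSingletonClass μ) μ
  obtain ⟨M, hMm, hMc, hM0⟩ :=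
    exists_not_countable_measure_eq_zero (not_countable_of_nullSingletonClass ν) ν
  let bad : Set X := toMeasurable μ sᶜ ∪ (N ∪ T ⁻¹' M)
  have hbad : MeasurableSet bad :=
    (measurableSet_toMeasurable μ _).union (hNm.union (hT.measurable hMm))
  have hbad0 : μ bad = 0 := measure_union_null ((measure_toMeasurable _).trans hs)
    (measure_union_null hN0 ((hT.measure_preimage hMm.nullMeasurableSet).trans hM0))
  have hsub : badᶜ ⊆ s := compl_subset_comm.1
    ((subset_toMeasurable μ sᶜ).trans subset_union_left)
  have hM : M ⊆ (T '' badᶜ)ᶜ := by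
    rintro y hy ⟨x, hx, rfl⟩
    exact hx (Or.inr (Or.inr hy))
  obtain ⟨θ, hθ⟩ := exists_measurableEquiv_eqOn hT.measurable hbad.compl (hinj.mono hsub)
    (fun h => hNc (h.mono (by rw [compl_compl]; exact fun x hx => Or.inr (Or.inl hx))))
    (fun h => hMc (h.mono hM))
  have hae : θ =ᵐ[μ] T := by
    filter_upwards [compl_mem_ae_iff.2 hbad0] with x hx using hθ hx
  exact ⟨θ, ⟨θ.measurable, by rw [Measure.map_congr hae, hT.map_eq]⟩, hae⟩

theorem continuous_cdf (m : Measure ℝ) [IsProbabilityMeasure m] [NullSingletonClass m] :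
    Continuous (cdf m) := by
  refine continuous_iff_continuousAt.2 fun x => ?_
  have hjump := (cdf m).measure_singleton x
  rw [measure_cdf, measure_singleton] at hjump
  rw [(monotone_cdf m).continuousAt_iff_leftLim_eq_rightLim, StieltjesFunction.rightLim_eq]
  exact ((monotone_cdf m).leftLim_le le_rfl).antisymm
    (sub_nonpos.1 (ENNReal.ofReal_eq_zero.1 hjump.symm))

theorem exists_preimage_Iic_eq_Iic {F : ℝ → ℝ} (hF : Monotone F) (hc : Continuous F) {x z : ℝ}
    (hz : F x < F z) : ∃ s, F s = F x ∧ F ⁻¹' Iic (F x) = Iic s := by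
  have hbdd : BddAbove (F ⁻¹' {F x}) := ⟨z, fun w (hw : F w = F x) =>
    (hF.reflect_lt (hw.trans_lt hz)).le⟩
  have hs : F (sSup (F ⁻¹' {F x})) = F x :=
    (isClosed_singleton.preimage hc).csSup_mem ⟨x, rfl⟩ hbdd
  refine ⟨_, hs, Subset.antisymm (fun w hw => ?_) fun w hw => (hF hw).trans_eq hs⟩
  by_contra hlt
  exact hlt (le_csSup hbdd (le_antisymm hw (hs ▸ hF (not_le.1 hlt).le)))

theorem measure_preimage_cdf_Iic (m : Measure ℝ) [IsProbabilityMeasure m] [NullSingletonClass m]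
    (y : ℝ) : m (cdf m ⁻¹' Iic y) = ENNReal.ofReal (min 1 y) := by
  rcases le_or_gt 1 y with hy | hy
  · have huniv : cdf m ⁻¹' Iic y = univ := eq_univ_of_forall fun x => (cdf_le_one m x).trans hy
    rw [huniv, measure_univ, min_eq_left hy, ENNReal.ofReal_one]
  obtain ⟨z, hz⟩ := ((tendsto_cdf_atTop m).eventually_const_lt hy).exists
  rw [min_eq_right hy.le]
  by_cases hrange : y ∈ range (cdf m)
  · obtain ⟨x, rfl⟩ := hrange
    obtain ⟨s, hs, hpre⟩ := exists_preimage_Iic_eq_Iic (monotone_cdf m) (continuous_cdf m) hz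
    rw [hpre, ← hs, ofReal_cdf]
  · have hy0 : y ≤ 0 := by
      by_contra! hpos
      exact hrange (mem_range_of_exists_le_of_exists_ge (continuous_cdf m)
        (((tendsto_cdf_atBot m).eventually_lt_const hpos).exists.imp fun _ h => h.le) ⟨z, hz.le⟩)
    have hempty : cdf m ⁻¹' Iic y = ∅ := eq_empty_of_forall_notMem fun x hx =>
      hrange ⟨x, le_antisymm hx (hy0.trans (cdf_nonneg m x))⟩
    rw [hempty, measure_empty, ENNReal.ofReal_of_nonpos hy0]

theorem map_cdf (m : Measure ℝ) [IsProbabilityMeasure m] [NullSingletonClass m] :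
    m.map (cdf m) = volume.restrict (Icc 0 1) := by
  have hmeas : Measurable (cdf m) := (monotone_cdf m).measurable
  have := Measure.isProbabilityMeasure_map (μ := m) hmeas.aemeasurable
  refine Measure.ext_of_Iic _ _ fun y => ?_
  rw [Measure.map_apply hmeas measurableSet_Iic, Measure.restrict_apply measurableSet_Iic,
    measure_preimage_cdf_Iic, inter_comm, ← Ici_inter_Iic, inter_assoc, Iic_inter_Iic,
    Ici_inter_Iic, Real.volume_Icc, sub_zero]

theorem exists_countable_injOn_compl_preimage {F : ℝ → ℝ} (hF : Monotone F) :
    ∃ J : Set ℝ, J.Countable ∧ InjOn F (F ⁻¹' J)ᶜ := by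
  refine ⟨{y | (interior (F ⁻¹' {y})).Nonempty}, ?_, fun x hx y hy hxy => ?_⟩
  · exact PairwiseDisjoint.countable_of_nonempty_interior
      ((pairwise_disjoint_fiber F).set_pairwise _) fun y hy => hy
  · by_contra hne
    wlog hlt : x < y generalizing x y
    · exact this y hy x hx hxy.symm (Ne.symm hne) ((not_lt.1 hlt).lt_of_ne (Ne.symm hne))
    refine hx ((nonempty_Ioo.2 hlt).mono (interior_maximal (fun w hw => ?_) isOpen_Ioo))
    exact le_antisymm ((hF hw.2.le).trans_eq hxy.symm) (hF hw.1.le)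

instance isProbabilityMeasure_restrict_Icc :
    IsProbabilityMeasure (volume.restrict (Icc (0 : ℝ) 1)) := ⟨by simp⟩

section CdfIsomorphism

variable {X Y : Type*} [MeasurableSpace X] [StandardBorelSpace X] [MeasurableSpace Y]
  [StandardBorelSpace Y] {μ : Measure X} {ν : Measure Y} [IsProbabilityMeasure μ]
  [IsProbabilityMeasure ν] [NullSingletonClass μ] [NullSingletonClass ν]

theorem exists_measurableEquiv_ae_eq_cdf {φ : X → ℝ} (hφ : Measurable φ)
    (hinj : Function.Injective φ) :
    ∃ θ : X ≃ᵐ ℝ, MeasurePreserving θ μ (volume.restrict (Icc 0 1)) ∧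
      θ =ᵐ[μ] fun x => cdf (μ.map φ) (φ x) := by
  have := Measure.isProbabilityMeasure_map (μ := μ) hφ.aemeasurable
  have : NullSingletonClass (μ.map φ) := ⟨fun y => by
    rw [Measure.map_apply hφ (measurableSet_singleton y)]
    exact (subsingleton_singleton.preimage hinj).measure_zero μ⟩
  have hmono := monotone_cdf (μ.map φ)
  have hmp : MeasurePreserving (cdf (μ.map φ) ∘ φ) μ (volume.restrict (Icc 0 1)) :=
    ⟨hmono.measurable.comp hφ, by rw [← Measure.map_map hmono.measurable hφ, map_cdf]⟩
  obtain ⟨J, hJ, hJinj⟩ := exists_countable_injOn_compl_preimage hmono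
  exact exists_measurableEquiv_ae_eq hmp
    (hmp.quasiMeasurePreserving.ae (compl_mem_ae_iff.2 (hJ.measure_zero _)))
    fun x hx y hy hxy => hinj (hJinj hx hy hxy)

theorem exists_measureReal_eq (μ : Measure X) [IsProbabilityMeasure μ] [NullSingletonClass μ]
    {c : ℝ} (h0 : 0 ≤ c) (h1 : c ≤ 1) : ∃ s : Set X, MeasurableSet s ∧ μ.real s = c := by
  have hemb := measurableEmbedding_embeddingReal X
  obtain ⟨θ, hθ, -⟩ := exists_measurableEquiv_ae_eq_cdf (μ := μ) hemb.measurable hemb.injective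
  refine ⟨θ ⁻¹' Icc 0 c, θ.measurable measurableSet_Icc, ?_⟩
  rw [measureReal_def, hθ.measure_preimage measurableSet_Icc.nullMeasurableSet,
    Measure.restrict_apply measurableSet_Icc, inter_eq_left.2 (Icc_subset_Icc_right h1),
    Real.volume_Icc, sub_zero, ENNReal.toReal_ofReal h0]

/-- An injection of a standard Borel space into `ℝ` that maps the level set `{g = n}` into
`(n, n + 1)`. Its distribution function separates the level sets of `g`, which is how
isomorphisms respecting `g` are built. -/
noncomputable def labelledEmbedding (g : X → ℕ) (x : X) : ℝ :=
  g x + Real.sigmoid (embeddingReal X x)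

theorem measurable_labelledEmbedding {g : X → ℕ} (hg : Measurable g) :
    Measurable (labelledEmbedding g) :=
  (measurable_from_top.comp hg).add (Real.sigmoid_strictMono.monotone.measurable.comp
    (measurableEmbedding_embeddingReal X).measurable)

theorem labelledEmbedding_le_natCast_iff (g : X → ℕ) (x : X) (n : ℕ) :
    labelledEmbedding g x ≤ n ↔ g x < n := by
  have h0 := Real.sigmoid_pos (embeddingReal X x)
  have h1 := Real.sigmoid_lt_one (embeddingReal X x)
  unfold labelledEmbedding
  refine ⟨fun h => by exact_mod_cast (by linarith : (g x : ℝ) < n), fun h => ?_⟩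
  have : (g x : ℝ) + 1 ≤ n := by exact_mod_cast h
  linarith

theorem labelledEmbedding_injective (g : X → ℕ) : Function.Injective (labelledEmbedding g) := by
  intro x y hxy
  have hg : g x = g y := eq_of_forall_gt_iff fun n => by
    rw [← labelledEmbedding_le_natCast_iff, ← labelledEmbedding_le_natCast_iff, hxy]
  refine (measurableEmbedding_embeddingReal X).injective (Real.sigmoid_strictMono.injective ?_)
  rwa [labelledEmbedding, labelledEmbedding, hg, add_right_inj] at hxy

theorem cdf_map_labelledEmbedding_natCast (μ : Measure X) [IsProbabilityMeasure μ] {g : X → ℕ}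
    (hg : Measurable g) (n : ℕ) :
    cdf (μ.map (labelledEmbedding g)) n = (μ.map g).real (Iio n) := by
  have hφ := measurable_labelledEmbedding hg
  have := Measure.isProbabilityMeasure_map (μ := μ) hφ.aemeasurable
  rw [cdf_eq_real, map_measureReal_apply hφ measurableSet_Iic,
    map_measureReal_apply hg measurableSet_Iio]
  exact congrArg μ.real (Set.ext fun x => labelledEmbedding_le_natCast_iff g x n)

theorem cdf_map_labelledEmbedding_le (μ : Measure X) [IsProbabilityMeasure μ] {g : X → ℕ}
    (hg : Measurable g) {x : X} {n : ℕ} (hn : g x < n) :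
    cdf (μ.map (labelledEmbedding g)) (labelledEmbedding g x) ≤ (μ.map g).real (Iio n) := by
  rw [← cdf_map_labelledEmbedding_natCast μ hg]
  exact monotone_cdf _ ((labelledEmbedding_le_natCast_iff g x n).2 hn)

theorem le_cdf_map_labelledEmbedding (μ : Measure X) [IsProbabilityMeasure μ] {g : X → ℕ}
    (hg : Measurable g) {x : X} {n : ℕ} (hn : n ≤ g x) :
    (μ.map g).real (Iio n) ≤ cdf (μ.map (labelledEmbedding g)) (labelledEmbedding g x) := by
  rw [← cdf_map_labelledEmbedding_natCast μ hg]
  refine monotone_cdf _ (le_of_lt ?_)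
  rw [← not_le, labelledEmbedding_le_natCast_iff]
  exact hn.not_gt

theorem exists_measurableEquiv_comp_ae_eq {g : X → ℕ} {h : Y → ℕ} (hg : Measurable g)
    (hh : Measurable h) (hgh : μ.map g = ν.map h) :
    ∃ θ : X ≃ᵐ Y, MeasurePreserving θ μ ν ∧ h ∘ θ =ᵐ[μ] g := by
  obtain ⟨α, hα, hα'⟩ := exists_measurableEquiv_ae_eq_cdf (μ := μ)
    (measurable_labelledEmbedding hg) (labelledEmbedding_injective g)
  obtain ⟨β, hβ, hβ'⟩ := exists_measurableEquiv_ae_eq_cdf (μ := ν)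
    (measurable_labelledEmbedding hh) (labelledEmbedding_injective h)
  have hθ : MeasurePreserving (α.trans β.symm) μ ν := (hβ.symm β).comp hα
  have hα_notMem : ∀ᵐ x ∂μ, α x ∉ range fun n : ℕ => (μ.map g).real (Iio n) :=
    hα.quasiMeasurePreserving.ae ((countable_range _).ae_notMem _)
  refine ⟨α.trans β.symm, hθ, ?_⟩
  filter_upwards [hα', hθ.quasiMeasurePreserving.ae hβ', hα_notMem] with x hx hy hx_notMem
  rw [MeasurableEquiv.trans_apply, β.apply_symm_apply] at hy
  rcases lt_trichotomy (h (β.symm (α x))) (g x) with hlt | heq | hlt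
  · refine absurd ⟨g x, le_antisymm ?_ ?_⟩ hx_notMem
    · exact (le_cdf_map_labelledEmbedding μ hg le_rfl).trans_eq hx.symm
    · rw [hgh]
      exact hy.trans_le (cdf_map_labelledEmbedding_le ν hh hlt)
  · exact heq
  · refine absurd ⟨h (β.symm (α x)), le_antisymm ?_ ?_⟩ hx_notMem
    · rw [hgh]
      exact (le_cdf_map_labelledEmbedding ν hh le_rfl).trans_eq hy.symm
    · exact hx.trans_le (cdf_map_labelledEmbedding_le μ hg hlt)

theorem exists_measurableEquiv_preimage_ae_eq {f : Y → X} (hf : MeasurePreserving f ν μ)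
    {ι : Type*} [Finite ι] {B : ι → Set X} (hB : ∀ j, MeasurableSet (B j)) :
    ∃ θ : X ≃ᵐ Y, MeasurePreserving θ μ ν ∧ ∀ j, θ ⁻¹' (f ⁻¹' B j) =ᵐ[μ] B j := by
  obtain ⟨code, hcode⟩ := exists_injective_nat (ι → Prop)
  let name : X → ℕ := fun x => code fun j => x ∈ B j
  have hname : Measurable name :=
    (Measurable.of_discrete (f := code)).comp (measurable_pi_iff.2 fun j => (hB j).mem)
  obtain ⟨θ, hθ, hθname⟩ := exists_measurableEquiv_comp_ae_eq (μ := μ) (ν := ν) hname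
    (hname.comp hf.measurable) (by rw [← Measure.map_map hname hf.measurable, hf.map_eq])
  refine ⟨θ, hθ, fun j => ?_⟩
  filter_upwards [hθname] with x hx using congrFun (hcode hx) j

end CdfIsomorphism

end NonatomicIsomorphism

section MeasureAlgebra

open scoped ENNReal

variable {X Y : Type*} [MeasurableSpace X] [MeasurableSpace Y] {μ : Measure X} {ν : Measure Y}

theorem inseparable_measuredSets_iff {s t : MeasuredSets μ} :
    Inseparable s t ↔ (s : Set X) =ᵐ[μ] (t : Set X) := by
  rw [EMetric.inseparable_iff, MeasuredSets.edist_def, measure_symmDiff_eq_zero_iff]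

theorem symmDiff_limsup_subset {α : Type*} (u : ℕ → Set α) (N : ℕ) :
    u N ∆ limsup u atTop ⊆ ⋃ k, u (N + k) ∆ u (N + k + 1) := by
  intro x hx
  by_contra hnot
  have hstep : ∀ k, x ∈ u (N + k) ↔ x ∈ u (N + (k + 1)) := fun k => by
    by_contra hne
    exact hnot (Set.mem_iUnion.2 ⟨k, by rw [Set.mem_symmDiff]; tauto⟩)
  have hconst : ∀ k, x ∈ u (N + k) ↔ x ∈ u N := fun k => by
    induction k with
    | zero => rfl
    | succ k ih => exact (hstep k).symm.trans ih
  have hlim : x ∈ limsup u atTop ↔ x ∈ u N := by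
    rw [mem_limsup_iff_frequently_mem]
    have hev : ∀ᶠ n in atTop, (x ∈ u n ↔ x ∈ u N) := by
      filter_upwards [eventually_ge_atTop N] with n hn
      simpa only [Nat.add_sub_cancel' hn] using hconst (n - N)
    rw [frequently_congr hev, frequently_const]
  simp [Set.mem_symmDiff, hlim] at hx

instance completeSpace_measuredSets : CompleteSpace (MeasuredSets μ) := by
  refine EMetric.complete_of_convergent_controlled_sequences (fun n => 2⁻¹ ^ n)
    (fun n => ENNReal.pow_pos (by simp) n) fun u hu => ?_
  refine ⟨⟨limsup (fun n => (u n : Set X)) atTop,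
    MeasurableSet.measurableSet_limsup fun n => (u n).2⟩, tendsto_iff_edist_tendsto_0.2 ?_⟩
  have hgeom : Tendsto (fun N : ℕ => (2⁻¹ : ℝ≥0∞) ^ N * 2) atTop (𝓝 0) := by
    simpa using ENNReal.Tendsto.mul_const
      (ENNReal.tendsto_pow_atTop_nhds_zero_of_lt_one ENNReal.one_half_lt_one)
      (Or.inr ENNReal.ofNat_ne_top)
  refine tendsto_of_tendsto_of_tendsto_of_le_of_le tendsto_const_nhds hgeom
    (fun _ => zero_le) fun N => ?_
  calc μ ((u N : Set X) ∆ limsup (fun n => (u n : Set X)) atTop)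
      ≤ ∑' k, edist (u (N + k)) (u (N + k + 1)) :=
        (measure_mono (symmDiff_limsup_subset (fun n => (u n : Set X)) N)).trans
          (measure_iUnion_le _)
    _ ≤ ∑' k : ℕ, 2⁻¹ ^ (N + k) :=
        ENNReal.tsum_le_tsum fun k => (hu _ _ _ le_rfl (Nat.le_succ _)).le
    _ = 2⁻¹ ^ N * 2 := by
        simp only [pow_add, ENNReal.tsum_mul_left, ENNReal.tsum_geometric,
          ENNReal.one_sub_inv_two, inv_inv]

/-- The map that a measure preserving transformation induces on measurable sets by taking
preimages. -/
def measuredPreimage (f : X → Y) (hf : MeasurePreserving f μ ν) (s : MeasuredSets ν) :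
    MeasuredSets μ :=
  ⟨f ⁻¹' s, hf.measurable s.2⟩

theorem isometry_measuredPreimage {f : X → Y} (hf : MeasurePreserving f μ ν) :
    Isometry (measuredPreimage f hf) := fun s t => by
  rw [MeasuredSets.edist_def, MeasuredSets.edist_def]
  exact hf.measure_preimage (s.2.symmDiff t.2).nullMeasurableSet

section PointRealization

variable {ι κ : Type*} {l : Filter ι} {V : ι → X → Y} {hV : ∀ i, MeasurePreserving (V i) μ ν}

/-- The code of a point: the record of which members of a family of sets contain it. Maps into a
space with a countable separating family are recovered from the codes of their values. -/
def membershipCode (C : κ → MeasuredSets μ) (x : X) (k : κ) : Prop := x ∈ (C k : Set X)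

theorem measurable_membershipCode (C : κ → MeasuredSets μ) : Measurable (membershipCode C) :=
  measurable_pi_iff.2 fun k => (C k).2.mem

theorem tendsto_measuredPreimage_membershipCode {C : κ → MeasuredSets ν}
    {D : κ → MeasuredSets μ}
    (h : ∀ k, Tendsto (fun i => measuredPreimage (V i) (hV i) (C k)) l (𝓝 (D k)))
    {E : Set (κ → Prop)} (hE : MeasurableSet E) {s : Finset κ} (hs : DependsOn (· ∈ E) s) :
    Tendsto (fun i => measuredPreimage (V i) (hV i)
      ⟨membershipCode C ⁻¹' E, (measurable_membershipCode C) hE⟩) l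
      (𝓝 ⟨membershipCode D ⁻¹' E, (measurable_membershipCode D) hE⟩) := by
  refine tendsto_iff_edist_tendsto_0.2 ?_
  have hsum := tendsto_finsetSum s fun k _ => tendsto_iff_edist_tendsto_0.1 (h k)
  rw [Finset.sum_const_zero] at hsum
  refine tendsto_of_tendsto_of_tendsto_of_le_of_le tendsto_const_nhds hsum
    (fun _ => zero_le) fun i => (measure_mono fun x hx => ?_).trans (measure_biUnion_finset_le s _)
  by_contra hnot
  have hcode : ∀ k ∈ s, membershipCode C (V i x) k = membershipCode D x k := fun k hk => by
    by_contra hne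
    refine hnot (Set.mem_iUnion₂.2 ⟨k, hk, ?_⟩)
    have hne' : ¬ (V i x ∈ (C k : Set Y) ↔ x ∈ (D k : Set X)) := fun h => hne (propext h)
    change (V i x ∈ (C k : Set Y) ∧ _) ∨ _
    tauto
  have hiff : membershipCode C (V i x) ∈ E ↔ membershipCode D x ∈ E := iff_of_eq (hs hcode)
  rcases hx with ⟨hin, hout⟩ | ⟨hin, hout⟩
  · exact hout (hiff.1 hin)
  · exact hout (hiff.2 hin)

theorem map_membershipCode_eq [IsFiniteMeasure μ] [l.NeBot] {C : κ → MeasuredSets ν}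
    {D : κ → MeasuredSets μ}
    (h : ∀ k, Tendsto (fun i => measuredPreimage (V i) (hV i) (C k)) l (𝓝 (D k))) :
    μ.map (membershipCode D) = ν.map (membershipCode C) := by
  have hcyl : ∀ E ∈ measurableCylinders fun _ : κ => Prop,
      μ.map (membershipCode D) E = ν.map (membershipCode C) E := by
    intro E hE
    obtain ⟨s, S, -, rfl⟩ := (mem_measurableCylinders E).1 hE
    have hmeas := MeasurableSet.of_mem_measurableCylinders hE
    have hdep : DependsOn (· ∈ cylinder (α := fun _ => Prop) s S) s := fun a b hab => by
      simp only [mem_cylinder, Finset.dependsOn_restrict s hab]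
    rw [Measure.map_apply (measurable_membershipCode D) hmeas,
      Measure.map_apply (measurable_membershipCode C) hmeas]
    refine tendsto_nhds_unique ((MeasuredSets.continuous_measure.tendsto _).comp
      (tendsto_measuredPreimage_membershipCode h hmeas hdep)) ?_
    refine tendsto_const_nhds.congr fun i => ?_
    exact ((hV i).measure_preimage (measurable_membershipCode C hmeas).nullMeasurableSet).symm
  exact ext_of_generate_finite _ generateFrom_measurableCylinders.symm
    isPiSystem_measurableCylinders hcyl (hcyl _ (univ_mem_measurableCylinders _))

variable [IsFiniteMeasure μ] [StandardBorelSpace Y] [Nonempty Y] [l.NeBot]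

theorem exists_measurePreserving_of_tendsto_of_separating [Countable κ]
    {C : κ → MeasuredSets ν} {D : κ → MeasuredSets μ}
    (hC : Function.Injective (membershipCode C))
    (h : ∀ k, Tendsto (fun i => measuredPreimage (V i) (hV i) (C k)) l (𝓝 (D k))) :
    ∃ T : X → Y, MeasurePreserving T μ ν ∧ ∀ k, T ⁻¹' (C k) =ᵐ[μ] (D k : Set X) := by
  have hemb : MeasurableEmbedding (membershipCode C) :=
    (measurable_membershipCode C).measurableEmbedding hC
  obtain ⟨decode, hdecode, hleft⟩ := hemb.exists_measurable_extend measurable_id fun _ => ‹_›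
  have hmap := map_membershipCode_eq h
  have hcode := measurable_membershipCode D
  refine ⟨decode ∘ membershipCode D, ⟨hdecode.comp hcode, ?_⟩, fun k => ?_⟩
  · rw [← Measure.map_map hdecode hcode, hmap, Measure.map_map hdecode hemb.measurable, hleft,
      Measure.map_id]
  · have hrange : ∀ᵐ x ∂μ, membershipCode D x ∈ Set.range (membershipCode C) := by
      refine ae_of_ae_map hcode.aemeasurable ?_
      rw [hmap]
      exact ae_map_mem_range _ hemb.measurableSet_range ν
    filter_upwards [hrange] with x ⟨y, hy⟩
    have hdec : decode (membershipCode D x) = y := by rw [← hy]; exact congrFun hleft y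
    exact (congrArg (· ∈ (C k : Set Y)) hdec).trans (congrFun hy k)

theorem exists_measurePreserving_of_forall_tendsto
    (h : ∀ C : MeasuredSets ν, ∃ D, Tendsto (fun i => measuredPreimage (V i) (hV i) C) l (𝓝 D)) :
    ∃ (T : X → Y) (hT : MeasurePreserving T μ ν), ∀ C,
      Tendsto (fun i => measuredPreimage (V i) (hV i) C) l (𝓝 (measuredPreimage T hT C)) := by
  choose D hD using h
  obtain ⟨S, hS, hsep⟩ := exists_seq_separating Y MeasurableSet.empty Set.univ
  let sepSet : ℕ → MeasuredSets ν := fun k => ⟨S k, hS k⟩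
  have hinj : Function.Injective (membershipCode sepSet) := fun y z hyz =>
    hsep y trivial z trivial fun k => iff_of_eq (congrFun hyz k)
  obtain ⟨T, hT, hTS⟩ :=
    exists_measurePreserving_of_tendsto_of_separating hinj fun k => hD (sepSet k)
  refine ⟨T, hT, fun C => ?_⟩
  let insertC : Option ℕ → MeasuredSets ν := fun o => o.elim C sepSet
  obtain ⟨T', -, hTS'⟩ := exists_measurePreserving_of_tendsto_of_separating
    (fun y z hyz => hinj (funext fun k => congrFun hyz (some k)) :
      Function.Injective (membershipCode insertC)) fun o => hD (insertC o)
  have hTT' : T =ᵐ[μ] T' := by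
    filter_upwards [ae_all_iff.2 hTS, ae_all_iff.2 fun k => hTS' (some k)] with x hx hx'
    exact hinj (funext fun k => (hx k).trans (hx' k).symm)
  have hTC : Inseparable (D C) (measuredPreimage T hT C) := inseparable_measuredSets_iff.2
    ((hTS' none).symm.trans (hTT'.symm.preimage (s := (C : Set Y))))
  rw [← hTC.nhds_eq]
  exact hD C

end PointRealization

end MeasureAlgebra

theorem tendsto_apply_of_isometry {α β ι : Type*} [PseudoMetricSpace α] [PseudoMetricSpace β]
    {l : Filter ι} {f : ι → α → β} (hf : ∀ i, Isometry (f i)) {x : ι → α} {a : α} {b : β}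
    (hx : Tendsto x l (𝓝 a)) (hfa : Tendsto (fun i => f i a) l (𝓝 b)) :
    Tendsto (fun i => f i (x i)) l (𝓝 b) :=
  (tendsto_iff_of_dist (by simpa only [(hf _).dist_eq] using tendsto_iff_dist_tendsto_zero.1 hx)).2
    hfa

theorem dist_eq_dist_of_inseparable {α : Type*} [PseudoMetricSpace α] {x x' y y' : α}
    (hx : Inseparable x x') (hy : Inseparable y y') : dist x y = dist x' y' := by
  rw [dist_edist, dist_edist,
    edist_congr (EMetric.inseparable_iff.1 hx) (EMetric.inseparable_iff.1 hy)]

theorem IsDenseSetSeq.exists_denseRange {X : Type*} [MeasurableSpace X] {μ : Measure X}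
    [IsFiniteMeasure μ] {A : ℕ → Set X} (hA : IsDenseSetSeq μ A) :
    ∃ B : ℕ → MeasuredSets μ, DenseRange B ∧ A = fun i => (B i : Set X) := by
  refine ⟨fun i => ⟨A i, hA.1 i⟩, Metric.denseRange_iff.2 fun C ε hε => ?_, rfl⟩
  obtain ⟨i, hi⟩ := hA.2 C C.2 ε hε
  exact ⟨i, (dist_comm C _).trans_lt hi⟩

namespace MeasureAut

variable {X : Type*} [MeasurableSpace X] {μ : Measure X}

section Action

/-- The action of an automorphism on measurable sets: `image T` as a self-map of the metric space
`MeasuredSets μ`. Sets are not identified modulo null sets there, so the identities of an action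
hold up to `Inseparable`. -/
noncomputable def act (T : MeasureAut μ) : MeasuredSets μ → MeasuredSets μ :=
  measuredPreimage ((Quotient.out T : mpGroup μ) : Equiv.Perm X).symm
    (Quotient.out T : mpGroup μ).2.2

theorem coe_act (T : MeasureAut μ) (B : MeasuredSets μ) : (act T B : Set X) = image T B :=
  (Equiv.image_eq_preimage_symm _ _).symm

theorem isometry_act (T : MeasureAut μ) : Isometry (act T) := isometry_measuredPreimage _

theorem act_mk (S : mpGroup μ) (B : MeasuredSets μ) :
    Inseparable (act (QuotientGroup.mk S : MeasureAut μ) B)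
      (measuredPreimage (S : Equiv.Perm X).symm S.2.2 B) :=
  inseparable_measuredSets_iff.2 <| by
    rw [coe_act]
    exact (image_mk S B).trans (EventuallyEq.of_eq (Equiv.image_eq_preimage_symm _ _))

theorem act_mul (S T : MeasureAut μ) (B : MeasuredSets μ) :
    Inseparable (act (S * T) B) (act S (act T B)) := by
  have hST : S * T = QuotientGroup.mk (Quotient.out S * Quotient.out T : mpGroup μ) := by
    rw [QuotientGroup.mk_mul, QuotientGroup.out_eq', QuotientGroup.out_eq']
  rw [hST]
  exact act_mk _ B

theorem act_one (B : MeasuredSets μ) : Inseparable (act 1 B) B := act_mk 1 B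

theorem act_act_inv (T : MeasureAut μ) (B : MeasuredSets μ) : Inseparable (act T (act T⁻¹ B)) B :=
  (act_mul T T⁻¹ B).symm.trans (by rw [mul_inv_cancel]; exact act_one B)

theorem dist_act_inv [IsFiniteMeasure μ] (S T : MeasureAut μ) (B : MeasuredSets μ) :
    dist (act S⁻¹ B) (act T⁻¹ B) = dist (act S (act T⁻¹ B)) (act T (act T⁻¹ B)) := by
  rw [← (isometry_act S).dist_eq, dist_eq_dist_of_inseparable
    ((act_act_inv S B).trans (act_act_inv T B).symm) .rfl, dist_comm]

end Action

section HalmosTopology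

theorem halmosTerm_eq_dist_add_dist [IsFiniteMeasure μ] (B : ℕ → MeasuredSets μ)
    (S T : MeasureAut μ) (i : ℕ) :
    halmosTerm (fun i => (B i : Set X)) S T i =
      dist (act S (B i)) (act T (B i)) + dist (act S⁻¹ (B i)) (act T⁻¹ (B i)) := by
  simp only [MeasuredSets.dist_def, coe_act, halmosTerm]

theorem halmosDist_inv_inv (A : ℕ → Set X) (S T : MeasureAut μ) :
    halmosDist A S⁻¹ T⁻¹ = halmosDist A S T := by
  simp only [halmosDist, halmosTerm, inv_inv, add_comm]

variable [IsProbabilityMeasure μ] {B : ℕ → MeasuredSets μ}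

theorem dist_act_le_mul_halmosDist (B : ℕ → MeasuredSets μ) (S T : MeasureAut μ) (i : ℕ) :
    dist (act S (B i)) (act T (B i)) ≤ 2 ^ i * halmosDist (fun i => (B i : Set X)) S T := by
  have hterm := (summable_halmos (fun i => (B i : Set X)) S T).le_tsum i
    fun j _ => mul_nonneg (by positivity) (halmosTerm_nonneg _ S T j)
  calc dist (act S (B i)) (act T (B i)) ≤ halmosTerm (fun i => (B i : Set X)) S T i := by
        rw [halmosTerm_eq_dist_add_dist]
        exact le_add_of_nonneg_right dist_nonneg
    _ = 2 ^ i * ((1 / 2 : ℝ) ^ i * halmosTerm (fun i => (B i : Set X)) S T i) := by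
        rw [← mul_assoc, ← mul_pow, mul_one_div_cancel two_ne_zero, one_pow, one_mul]
    _ ≤ 2 ^ i * halmosDist (fun i => (B i : Set X)) S T :=
        mul_le_mul_of_nonneg_left hterm (by positivity)

theorem uniformContinuous_act (hB : DenseRange B) (C : MeasuredSets μ) :
    letI := halmosPseudoMetric μ fun i => (B i : Set X)
    UniformContinuous fun T : MeasureAut μ => act T C := by
  let := halmosPseudoMetric μ fun i => (B i : Set X)
  refine uniformContinuous_of_uniform_approx_of_uniformContinuous fun u hu => ?_
  obtain ⟨ε, hε, hεu⟩ := Metric.mem_uniformity_dist.1 hu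
  obtain ⟨i, hi⟩ := hB.exists_dist_lt C hε
  refine ⟨fun T => act T (B i), ?_, fun T =>
    hεu (((isometry_act T).dist_eq C (B i)).trans_lt hi)⟩
  exact (LipschitzWith.of_dist_le_mul (K := 2 ^ i) fun S T => by
    simpa using! dist_act_le_mul_halmosDist B S T i).uniformContinuous

theorem tendsto_halmosDist_of_tendsto_halmosTerm {A : ℕ → Set X} {ι : Type*}
    {u : ι → MeasureAut μ} {l : Filter ι} {S : MeasureAut μ}
    (h : ∀ i, Tendsto (fun j => halmosTerm A (u j) S i) l (𝓝 0)) :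
    Tendsto (fun j => halmosDist A (u j) S) l (𝓝 0) := by
  have hterm (j : ι) (i : ℕ) : halmosTerm A (u j) S i ≤ 2 :=
    (add_le_add measureReal_le_one measureReal_le_one).trans_eq one_add_one_eq_two
  rw [show (0 : ℝ) = ∑' i : ℕ, (1 / 2 : ℝ) ^ i * 0 by simp]
  refine tendsto_tsum_of_dominated_convergence (summable_geometric_two.mul_right 2)
    (fun i => (h i).const_mul _) (Eventually.of_forall fun j i => ?_)
  rw [Real.norm_of_nonneg (mul_nonneg (by positivity) (halmosTerm_nonneg A _ _ i))]
  exact mul_le_mul_of_nonneg_left (hterm j i) (by positivity)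

theorem tendsto_halmos_iff (hB : DenseRange B) {ι : Type*} {u : ι → MeasureAut μ}
    {l : Filter ι} {S : MeasureAut μ} :
    letI := halmosPseudoMetric μ fun i => (B i : Set X)
    Tendsto u l (𝓝 S) ↔ ∀ C, Tendsto (fun i => act (u i) C) l (𝓝 (act S C)) := by
  let := halmosPseudoMetric μ fun i => (B i : Set X)
  refine ⟨fun hu C => ((uniformContinuous_act hB C).continuous.tendsto S).comp hu, fun hu =>
    tendsto_iff_dist_tendsto_zero.2 (tendsto_halmosDist_of_tendsto_halmosTerm fun i => ?_)⟩
  have hdist (C : MeasuredSets μ) := tendsto_iff_dist_tendsto_zero.1 (hu C)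
  simpa only [halmosTerm_eq_dist_add_dist, dist_act_inv, add_zero] using
    (hdist (B i)).add (hdist (act S⁻¹ (B i)))

theorem isTopologicalGroup_halmos (hB : DenseRange B) :
    letI := halmosPseudoMetric μ fun i => (B i : Set X)
    IsTopologicalGroup (MeasureAut μ) := by
  let := halmosPseudoMetric μ fun i => (B i : Set X)
  have hact (C : MeasuredSets μ) := (uniformContinuous_act hB C).continuous
  refine { continuous_inv := (Isometry.of_dist_eq (halmosDist_inv_inv _)).continuous,
           continuous_mul := continuous_iff_continuousAt.2 fun p =>
             (tendsto_halmos_iff hB).2 fun C => ?_ }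
  rw [act_mul p.1 p.2 C]
  refine (tendsto_iff_of_dist ?_).2 <| tendsto_apply_of_isometry (fun q => isometry_act q.1)
    ((hact C).comp continuous_snd).continuousAt
    ((hact (act p.2 C)).comp continuous_fst).continuousAt
  exact tendsto_const_nhds.congr fun q => (act_mul q.1 q.2 C).dist_eq_zero.symm

end HalmosTopology

section Completeness

/-- A measure preserving measurable equivalence, as an element of the group `mpGroup μ` in which
automorphisms have their representatives. -/
def mpGroupOfEquiv (θ : X ≃ᵐ X) (hθ : MeasurePreserving θ μ μ) : mpGroup μ :=
  ⟨θ.toEquiv, hθ, hθ.symm θ⟩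

theorem act_inv_mk_mpGroupOfEquiv (θ : X ≃ᵐ X) (hθ : MeasurePreserving θ μ μ)
    (C : MeasuredSets μ) :
    Inseparable (act (QuotientGroup.mk (mpGroupOfEquiv θ hθ) : MeasureAut μ)⁻¹ C)
      (measuredPreimage θ hθ C) :=
  act_mk (mpGroupOfEquiv θ hθ)⁻¹ C

theorem ae_comp_eq_self_of_tendsto_act [StandardBorelSpace X] [IsFiniteMeasure μ] {ι : Type*}
    {l : Filter ι} [l.NeBot] {u : ι → MeasureAut μ} {V W : X → X} (hV : MeasurePreserving V μ μ)
    (hW : MeasurePreserving W μ μ)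
    (hVu : ∀ C, Tendsto (fun i => act (u i) C) l (𝓝 (measuredPreimage V hV C)))
    (hWu : ∀ C, Tendsto (fun i => act (u i)⁻¹ C) l (𝓝 (measuredPreimage W hW C))) :
    ∀ᵐ x ∂μ, W (V x) = x := by
  refine EventuallyEq.of_forall_separating_preimage (g := id) MeasurableSet fun C hC => ?_
  have hact : Tendsto (fun i => act (u i) (act (u i)⁻¹ ⟨C, hC⟩)) l
      (𝓝 (measuredPreimage V hV (measuredPreimage W hW ⟨C, hC⟩))) :=
    tendsto_apply_of_isometry (fun i => isometry_act (u i)) (hWu _) (hVu _)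
  have hself : Tendsto (fun i => act (u i) (act (u i)⁻¹ ⟨C, hC⟩)) l
      (𝓝 (⟨C, hC⟩ : MeasuredSets μ)) :=
    (tendsto_iff_of_dist (tendsto_const_nhds.congr fun i =>
      (act_act_inv (u i) ⟨C, hC⟩).symm.dist_eq_zero.symm)).1 tendsto_const_nhds
  exact inseparable_measuredSets_iff.1 (tendsto_nhds_unique_inseparable hact hself)

variable [StandardBorelSpace X] [IsProbabilityMeasure μ] {B : ℕ → MeasuredSets μ}

theorem exists_measurePreserving_of_cauchySeq (hB : DenseRange B) {u : ℕ → MeasureAut μ}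
    (hu : letI := halmosPseudoMetric μ fun i => (B i : Set X); CauchySeq u) :
    ∃ (V : X → X) (hV : MeasurePreserving V μ μ),
      ∀ C, Tendsto (fun n => act (u n) C) atTop (𝓝 (measuredPreimage V hV C)) := by
  let := halmosPseudoMetric μ fun i => (B i : Set X)
  have : Nonempty X := μ.nonempty_of_neZero
  exact exists_measurePreserving_of_forall_tendsto fun C =>
    cauchySeq_tendsto_of_complete (hu.map (uniformContinuous_act hB C))

theorem completeSpace_halmos [NullSingletonClass μ] (hB : DenseRange B) :
    letI := halmosPseudoMetric μ fun i => (B i : Set X)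
    CompleteSpace (MeasureAut μ) := by
  let := halmosPseudoMetric μ fun i => (B i : Set X)
  refine Metric.complete_of_cauchySeq_tendsto fun u hu => ?_
  have huinv : CauchySeq fun n => (u n)⁻¹ :=
    hu.map (Isometry.of_dist_eq (halmosDist_inv_inv _)).uniformContinuous
  obtain ⟨V, hV, hVu⟩ := exists_measurePreserving_of_cauchySeq hB hu
  obtain ⟨W, hW, hWu⟩ := exists_measurePreserving_of_cauchySeq hB huinv
  obtain ⟨θ, hθ, hθV⟩ := exists_measurableEquiv_ae_eq hV
    (ae_comp_eq_self_of_tendsto_act hV hW hVu hWu) fun x hx y hy hxy =>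
      hx.symm.trans ((congrArg W hxy).trans hy)
  refine ⟨(QuotientGroup.mk (mpGroupOfEquiv θ hθ))⁻¹, (tendsto_halmos_iff hB).2 fun C => ?_⟩
  have hθC : Inseparable (measuredPreimage θ hθ C) (measuredPreimage V hV C) :=
    inseparable_measuredSets_iff.2 (hθV.preimage C)
  rw [act_inv_mk_mpGroupOfEquiv, hθC]
  exact hVu C

end Completeness

end MeasureAut

theorem tendsto_of_dist_lt_of_denseRange {α β : Type*} [UniformSpace α] [PseudoMetricSpace β]
    {F : ℕ → α → β} (hF : Equicontinuous F) {f : α → β} (hf : Continuous f) {x : ℕ → α}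
    (hx : DenseRange x) (hFf : ∀ k, ∀ i < k, dist (F k (x i)) (f (x i)) < 1 / ((k : ℝ) + 1))
    (a : α) : Tendsto (fun k => F k a) atTop (𝓝 (f a)) := by
  refine hx.induction_on a (hF.isClosed_setOfPred_tendsto hf) fun i => ?_
  refine tendsto_iff_dist_tendsto_zero.2 (squeeze_zero' (.of_forall fun _ => dist_nonneg) ?_
    tendsto_one_div_add_atTop_nhds_zero_nat)
  filter_upwards [eventually_gt_atTop i] with k hk using (hFf k i hk).le

theorem lipschitzWith_measureReal_inter_inter {X : Type*} [MeasurableSpace X] (μ : Measure X)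
    [IsFiniteMeasure μ] :
    LipschitzWith 3 fun p : MeasuredSets μ × MeasuredSets μ × MeasuredSets μ =>
      μ.real (p.1 ∩ p.2.1 ∩ p.2.2) := by
  refine .of_dist_le_mul fun ⟨A, B, C⟩ ⟨A', B', C'⟩ => ?_
  have hsub : ((A : Set X) ∩ B ∩ C) ∆ (A' ∩ B' ∩ C') ⊆ A ∆ A' ∪ B ∆ B' ∪ C ∆ C' := fun x => by
    simp only [Set.mem_symmDiff, Set.mem_inter_iff, Set.mem_union]
    tauto
  calc |μ.real (A ∩ B ∩ C) - μ.real (A' ∩ B' ∩ C')|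
      ≤ μ.real ((A ∩ B ∩ C) ∆ (A' ∩ B' ∩ C')) :=
        abs_measureReal_sub_le_measureReal_symmDiff
          ((A.2.inter B.2).inter C.2).nullMeasurableSet
          ((A'.2.inter B'.2).inter C'.2).nullMeasurableSet
    _ ≤ μ.real (A ∆ A') + μ.real (B ∆ B') + μ.real (C ∆ C') :=
        (measureReal_mono hsub).trans <| (measureReal_union_le _ _).trans <|
          add_le_add_left (measureReal_union_le _ _) _
    _ = dist A A' + dist B B' + dist C C' := by simp only [MeasuredSets.dist_def]
    _ ≤ 3 * dist (A, B, C) (A', B', C') := by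
        simp only [Prod.dist_eq]
        grind

namespace MeasureAut

variable {X : Type*} [MeasurableSpace X] {μ : Measure X}

section AsymmetricLimits

/-- The triple correlation `μ(C ∩ T^a C ∩ T^b C)`. -/
noncomputable def tripleCorr (T : MeasureAut μ) (a b : ℤ) (C : MeasuredSets μ) : ℝ :=
  μ.real (C ∩ act (T ^ a) C ∩ act (T ^ b) C)

theorem hasAsymmetricLimits_iff {T : MeasureAut μ} :
    T.HasAsymmetricLimits ↔ ∃ m n : ℕ → ℕ, Tendsto m atTop atTop ∧ Tendsto n atTop atTop ∧
      ∀ C : MeasuredSets μ,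
        Tendsto (fun i => tripleCorr T (m i) (n i) C) atTop
          (𝓝 ((μ.real C + 2 * μ.real C ^ 3) / 3)) ∧
        Tendsto (fun i => tripleCorr T (-m i) (-n i) C) atTop (𝓝 (μ.real C ^ 2)) := by
  simp only [tripleCorr, coe_act]
  exact exists₂_congr fun m n => and_congr_right fun _ => and_congr_right fun _ =>
    ⟨fun h C => h C C.2, fun h A hA => h ⟨A, hA⟩⟩

theorem measureReal_act (T : MeasureAut μ) (C : MeasuredSets μ) :
    μ.real (act T C) = μ.real C :=
  (Quotient.out T : mpGroup μ).2.2.measureReal_preimage C.2.nullMeasurableSet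

theorem act_conj_zpow (c T : MeasureAut μ) (a : ℤ) (C : MeasuredSets μ) :
    Inseparable (act ((c * T * c⁻¹) ^ a) (act c C)) (act c (act (T ^ a) C)) := by
  refine (act_mul _ c C).symm.trans ?_
  rw [conj_zpow, inv_mul_cancel_right]
  exact act_mul c (T ^ a) C

theorem tripleCorr_conj (c T : MeasureAut μ) (a b : ℤ) (C : MeasuredSets μ) :
    tripleCorr (c * T * c⁻¹) a b (act c C) = tripleCorr T a b C := by
  have hconj (k : ℤ) := inseparable_measuredSets_iff.1 (act_conj_zpow c T k C)
  calc tripleCorr (c * T * c⁻¹) a b (act c C)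
      = μ.real (act c C ∩ act c (act (T ^ a) C) ∩ act c (act (T ^ b) C)) :=
        measureReal_congr ((ae_eq_rfl.inter (hconj a)).inter (hconj b))
    _ = tripleCorr T a b C :=
        measureReal_act c ⟨C ∩ act (T ^ a) C ∩ act (T ^ b) C,
          (C.2.inter (act (T ^ a) C).2).inter (act (T ^ b) C).2⟩

theorem HasAsymmetricLimits.eq_of_isConj_inv {T : MeasureAut μ} (hT : T.HasAsymmetricLimits)
    (hconj : IsConj T T⁻¹) (C : MeasuredSets μ) :
    (μ.real C + 2 * μ.real C ^ 3) / 3 = μ.real C ^ 2 := by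
  obtain ⟨c, hc⟩ := isConj_iff.1 hconj
  obtain ⟨m, n, -, -, hlim⟩ := hasAsymmetricLimits_iff.1 hT
  have hcorr (a b : ℤ) : tripleCorr T (-a) (-b) (act c C) = tripleCorr T a b C := by
    rw [← tripleCorr_conj c T a b C, hc]
    simp only [tripleCorr, inv_zpow']
  have hinv := (hlim (act c C)).2
  simp only [hcorr, measureReal_act] at hinv
  exact tendsto_nhds_unique (hlim C).1 hinv

theorem HasAsymmetricLimits.isAsymmetric [StandardBorelSpace X] [IsProbabilityMeasure μ]
    [NullSingletonClass μ] {T : MeasureAut μ} (hT : T.HasAsymmetricLimits) : T.IsAsymmetric := by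
  intro hconj
  obtain ⟨C, hC, hCμ⟩ := exists_measureReal_eq μ (c := 1 / 3) (by norm_num) (by norm_num)
  have heq : (μ.real C + 2 * μ.real C ^ 3) / 3 = μ.real C ^ 2 :=
    hT.eq_of_isConj_inv hconj ⟨C, hC⟩
  norm_num [hCμ] at heq

theorem lipschitzWith_tripleCorr [IsFiniteMeasure μ] (T : MeasureAut μ) (a b : ℤ) :
    LipschitzWith 3 (tripleCorr T a b) := by
  simpa only [max_self, mul_one] using! (lipschitzWith_measureReal_inter_inter μ).comp
    (LipschitzWith.id.prodMk
      ((isometry_act (T ^ a)).lipschitz.prodMk (isometry_act (T ^ b)).lipschitz))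

theorem continuous_tripleCorr [IsProbabilityMeasure μ] {B : ℕ → MeasuredSets μ}
    (hB : DenseRange B) (a b : ℤ) (C : MeasuredSets μ) :
    letI := halmosPseudoMetric μ fun i => (B i : Set X)
    Continuous fun T : MeasureAut μ => tripleCorr T a b C := by
  let := halmosPseudoMetric μ fun i => (B i : Set X)
  have := isTopologicalGroup_halmos hB
  have hact (k : ℤ) : Continuous fun T : MeasureAut μ => act (T ^ k) C :=
    (uniformContinuous_act hB C).continuous.comp (continuous_zpow k)
  exact (lipschitzWith_measureReal_inter_inter μ).continuous.comp
    (continuous_const.prodMk ((hact a).prodMk (hact b)))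

/-- The automorphisms whose triple correlations, at some pair of times `m, n ≥ k`, come within
`1 / (k + 1)` of the asymmetric limits on the first `k` sets of a sequence. -/
def approxLimits (B : ℕ → MeasuredSets μ) (k : ℕ) : Set (MeasureAut μ) :=
  {T | ∃ m ≥ k, ∃ n ≥ k, ∀ i < k,
    dist (tripleCorr T m n (B i)) ((μ.real (B i) + 2 * μ.real (B i) ^ 3) / 3)
      < 1 / ((k : ℝ) + 1) ∧
    dist (tripleCorr T (-m) (-n) (B i)) (μ.real (B i) ^ 2) < 1 / ((k : ℝ) + 1)}

theorem isOpen_approxLimits [IsProbabilityMeasure μ] {B : ℕ → MeasuredSets μ}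
    (hB : DenseRange B) (k : ℕ) :
    letI := halmosPseudoMetric μ fun i => (B i : Set X)
    IsOpen (approxLimits B k) := by
  let := halmosPseudoMetric μ fun i => (B i : Set X)
  have hopen (a b : ℤ) (C : MeasuredSets μ) (x : ℝ) :
      IsOpen {T | dist (tripleCorr T a b C) x < 1 / ((k : ℝ) + 1)} :=
    isOpen_lt ((continuous_tripleCorr hB a b C).dist continuous_const) continuous_const
  simp only [approxLimits, Set.ofPred_exists, Set.ofPred_and, Set.ofPred_forall]
  exact isOpen_iUnion fun m => isOpen_const.inter <| isOpen_iUnion fun n => isOpen_const.inter <|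
    (Set.finite_Iio k).isOpen_biInter fun i _ => (hopen _ _ _ _).inter (hopen _ _ _ _)

theorem hasAsymmetricLimits_of_forall_mem_approxLimits [IsFiniteMeasure μ]
    {B : ℕ → MeasuredSets μ} (hB : DenseRange B) {T : MeasureAut μ}
    (hT : ∀ k, T ∈ approxLimits B k) : T.HasAsymmetricLimits := by
  choose m hm n hn hmn using hT
  have htripleCorr (a b : ℕ → ℤ) : Equicontinuous fun k => tripleCorr T (a k) (b k) :=
    (LipschitzWith.uniformEquicontinuous _ 3 fun k =>
      lipschitzWith_tripleCorr T (a k) (b k)).equicontinuous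
  have hreal := (MeasuredSets.lipschitzWith_measureReal (μ := μ)).continuous
  refine hasAsymmetricLimits_iff.2
    ⟨m, n, tendsto_atTop_mono hm tendsto_id, tendsto_atTop_mono hn tendsto_id, fun C => ⟨?_, ?_⟩⟩
  · exact tendsto_of_dist_lt_of_denseRange (htripleCorr _ _)
      (f := fun C : MeasuredSets μ => (μ.real C + 2 * μ.real C ^ 3) / 3) (by fun_prop) hB
      (fun k i hi => (hmn k i hi).1) C
  · exact tendsto_of_dist_lt_of_denseRange (htripleCorr _ _)
      (f := fun C : MeasuredSets μ => μ.real C ^ 2) (by fun_prop) hB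
      (fun k i hi => (hmn k i hi).2) C

end AsymmetricLimits

end MeasureAut

theorem measureReal_prod_uniformOn_univ {α β : Type*} [MeasurableSpace α] [MeasurableSpace β]
    [MeasurableSingletonClass β] [Fintype β] [Nonempty β] (ρ : Measure α) [IsFiniteMeasure ρ]
    {E : Set (α × β)} (hE : MeasurableSet E) :
    (ρ.prod (ProbabilityTheory.uniformOn Set.univ)).real E
      = (∑ i, ρ.real {a | (a, i) ∈ E}) / Fintype.card β := by
  have hpt (i : β) : ProbabilityTheory.uniformOn Set.univ {i} = (Fintype.card β : ENNReal)⁻¹ := by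
    rw [ProbabilityTheory.uniformOn_univ, Measure.count_singleton, one_div]
  rw [measureReal_def, Measure.prod_apply_symm hE, lintegral_fintype, ENNReal.toReal_sum
    fun i _ => ENNReal.mul_ne_top (measure_ne_top _ _) (measure_ne_top _ _), Finset.sum_div]
  refine Finset.sum_congr rfl fun i _ => ?_
  rw [hpt, ENNReal.toReal_mul, ENNReal.toReal_inv, ENNReal.toReal_natCast, div_eq_mul_inv]
  rfl

/-- The phase space of the coloured odometer: a point of `X` for every colour in `κ`, and a position
on a cycle that is cut into `N` consecutive windows of length `M`. -/
abbrev ColoredOdometer (X κ : Type*) (N M : ℕ) : Type _ := (κ → X) × ZMod (N * M)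

namespace ColoredOdometer

section Positions

variable {N M : ℕ}

/-- The window in which a position lies. -/
def window (p : ZMod (N * M)) : ZMod N := (p.val / M : ℕ)

/-- The place, from `0` to `M - 1`, of a position within its window. -/
def place (p : ZMod (N * M)) : ℕ := p.val % M

variable [NeZero N] [NeZero M]

theorem window_intCast (j : ℤ) : window (j : ZMod (N * M)) = (j / M : ℤ) := by
  have hM : (M : ℤ) ≠ 0 := NeZero.ne _
  have hj : j = (j : ZMod (N * M)).val + j / (N * M) * N * M := by
    rw [ZMod.val_intCast]
    push_cast
    linarith [Int.emod_add_mul_ediv j (N * M)]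
  have hdiv : j / M = ((j : ZMod (N * M)).val / M : ℕ) + j / (N * M) * N := by
    rw [Int.natCast_div, ← Int.add_mul_ediv_right _ _ hM, ← hj]
  rw [window, hdiv, Int.cast_add, Int.cast_mul, Int.cast_natCast, Int.cast_natCast,
    ZMod.natCast_self, mul_zero, add_zero]

theorem place_intCast (j : ℤ) : (place (j : ZMod (N * M)) : ℤ) = j % M := by
  rw [place, Int.natCast_mod, ZMod.val_intCast, Nat.cast_mul,
    Int.emod_emod_of_dvd _ (dvd_mul_left _ _)]

theorem window_sub_mul (p : ZMod (N * M)) (d : ℤ) :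
    window (p - (d * M : ℤ) : ZMod (N * M)) = window p - d := by
  obtain ⟨j, rfl⟩ := ZMod.intCast_surjective p
  rw [← Int.cast_sub, window_intCast, window_intCast, Int.sub_mul_ediv_right _ _ (NeZero.ne _),
    Int.cast_sub]

theorem place_sub_mul (p : ZMod (N * M)) (d : ℤ) :
    place (p - (d * M : ℤ) : ZMod (N * M)) = place p := by
  obtain ⟨j, rfl⟩ := ZMod.intCast_surjective p
  refine Nat.cast_injective (R := ℤ) ?_
  rw [← Int.cast_sub, place_intCast, place_intCast, Int.sub_mul_emod_self_right]

theorem window_add_one_and_place_add_one {p : ZMod (N * M)} (hp : place (p + 1) ≠ 0) :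
    window (p + 1) = window p ∧ place (p + 1) = place p + 1 := by
  obtain ⟨j, rfl⟩ := ZMod.intCast_surjective p
  have hM : (0 : ℤ) < M := mod_cast NeZero.pos M
  zify at hp ⊢
  rw [← Int.cast_one, ← Int.cast_add] at hp ⊢
  rw [place_intCast] at hp
  rw [window_intCast, window_intCast, place_intCast, place_intCast]
  have hr : j % M + 1 ≠ M := fun h => hp <| by rw [← Int.emod_add_emod, h, Int.emod_self]
  have hdivmod : (j + 1) / M = j / M ∧ (j + 1) % M = j % M + 1 :=
    (Int.ediv_emod_unique hM).2 ⟨by linarith [Int.emod_add_mul_ediv j M],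
      by linarith [Int.emod_nonneg j hM.ne'],
      lt_of_le_of_ne (Int.emod_lt_of_pos j hM) hr⟩
  exact ⟨congrArg _ hdivmod.1, mod_cast hdivmod.2⟩

/-- A position amounts to a window and a place. -/
noncomputable def windowPlaceEquiv : ZMod (N * M) ≃ ZMod N × Fin M :=
  Equiv.ofBijective (fun p => (window p, ⟨place p, Nat.mod_lt _ (NeZero.pos M)⟩)) <| by
    refine (Fintype.bijective_iff_injective_and_card _).2 ⟨fun p q hpq => ?_, by simp [ZMod.card]⟩
    have hlt (p : ZMod (N * M)) : p.val / M < N :=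
      Nat.div_lt_of_lt_mul (mul_comm N M ▸ p.val_lt)
    simp only [window, place, Prod.mk.injEq, Fin.mk.injEq, ZMod.natCast_eq_natCast_iff',
      Nat.mod_eq_of_lt (hlt _)] at hpq
    exact ZMod.val_injective _ (by rw [← Nat.div_add_mod p.val M, hpq.1, hpq.2, Nat.div_add_mod])

theorem sum_comp_window (f : ZMod N → ℝ) :
    (∑ p : ZMod (N * M), f (window p)) = M * ∑ t, f t := by
  refine (windowPlaceEquiv.sum_comp fun i : ZMod N × Fin M => f i.1).trans ?_
  simp [Fintype.sum_prod_type, Finset.mul_sum]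

end Positions

section Measure

variable {X κ : Type*} [MeasurableSpace X] [Fintype κ] {N M : ℕ} [NeZero N] [NeZero M]

/-- The product of independent copies of `μ`, one for every colour, and of the uniform distribution
on the positions. -/
noncomputable def measure (μ : Measure X) (κ : Type*) [Fintype κ] (N M : ℕ) :
    Measure (ColoredOdometer X κ N M) :=
  (Measure.pi fun _ : κ => μ).prod (ProbabilityTheory.uniformOn Set.univ)

variable {μ : Measure X} [IsProbabilityMeasure μ]

instance : IsProbabilityMeasure (measure μ κ N M) := by
  unfold measure
  infer_instance

instance [Nonempty κ] [NullSingletonClass μ] : NullSingletonClass (measure μ κ N M) := by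
  unfold measure
  infer_instance

theorem measureReal_eq {E : Set (ColoredOdometer X κ N M)} (hE : MeasurableSet E) :
    (measure μ κ N M).real E
      = (∑ p, (Measure.pi fun _ : κ => μ).real {x | (x, p) ∈ E}) / (N * M) := by
  rw [measure, measureReal_prod_uniformOn_univ _ hE, ZMod.card, Nat.cast_mul]

theorem measureReal_place_eq_zero :
    (measure μ κ N M).real {y | place y.2 = 0} = 1 / M := by
  have hsum : (∑ p : ZMod (N * M), if place p = 0 then (1 : ℝ) else 0) = N := by
    refine (windowPlaceEquiv.sum_comp
      fun i : ZMod N × Fin M => if i.2.val = 0 then (1 : ℝ) else 0).trans ?_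
    rw [Fintype.sum_prod_type]
    simp [Fin.val_eq_zero_iff, ZMod.card]
  have hslice (p : ZMod (N * M)) : (Measure.pi fun _ : κ => μ).real {_x | place p = 0}
      = if place p = 0 then 1 else 0 := by
    split_ifs with hp <;> simp [hp]
  have hE : MeasurableSet {y : ColoredOdometer X κ N M | place y.2 = 0} :=
    measurable_snd (MeasurableSet.of_discrete (s := {p | place p = 0}))
  rw [measureReal_eq hE]
  simp only [Set.mem_ofPred_eq, hslice, hsum]
  exact div_mul_cancel_left₀ (NeZero.ne _) _ |>.trans (one_div _).symm

theorem measurePreserving_add_left (c : ZMod (N * M)) :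
    MeasurePreserving (Prod.map id (c + ·)) (measure μ κ N M) (measure μ κ N M) := by
  refine (MeasurePreserving.id _).prod ?_
  rw [ProbabilityTheory.uniformOn, ProbabilityTheory.cond, Measure.restrict_univ]
  exact (MeasureTheory.measurePreserving_add_left Measure.count c).smul_measure _

/-- The action of the positions on the coloured odometer by translation. -/
noncomputable def translate : Multiplicative (ZMod (N * M)) →* mpGroup (measure μ κ N M) where
  toFun c := ⟨(Equiv.refl _).prodCongr (Equiv.addLeft c.toAdd),
    measurePreserving_add_left c.toAdd, measurePreserving_add_left (-c.toAdd)⟩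
  map_one' := by ext y <;> simp
  map_mul' c d := by ext y <;> simp [add_assoc]

/-- The odometer step: the transformation that moves every position by one. -/
noncomputable def step (μ : Measure X) [IsProbabilityMeasure μ] (κ : Type*) [Fintype κ] (N M : ℕ)
    [NeZero N] [NeZero M] : mpGroup (measure μ κ N M) := translate (.ofAdd 1)

theorem step_zpow_symm_apply (k : ℤ) (y : ColoredOdometer X κ N M) :
    (step μ κ N M ^ k).1.symm y = (y.1, y.2 - k) := by
  rw [step, ← map_zpow, ← ofAdd_zsmul, zsmul_one]
  exact Prod.ext rfl (neg_add_eq_sub _ _)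

end Measure

section Factor

variable {X κ : Type*} {N M : ℕ} [NeZero N] [NeZero M]

/-- The projection to `X` of the extension of `s : X → X` by a coloured odometer: in the window `t`
one follows the orbit under `s` of the point of colour `c t`. -/
def factor (s : X → X) (c : ZMod N → κ) (y : ColoredOdometer X κ N M) : X :=
  s^[place y.2] (y.1 (c (window y.2)))

theorem factor_add_one (s : X → X) (c : ZMod N → κ) (x : κ → X) {p : ZMod (N * M)}
    (hp : place (p + 1) ≠ 0) : factor s c (x, p + 1) = s (factor s c (x, p)) := by
  obtain ⟨hwindow, hplace⟩ := window_add_one_and_place_add_one hp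
  simp only [factor, hwindow, hplace, Function.iterate_succ_apply']

theorem factor_sub_mul (s : X → X) (c : ZMod N → κ) (x : κ → X) (p : ZMod (N * M)) (d : ℤ) :
    factor s c (x, p - ((d * M : ℤ) : ZMod (N * M))) = s^[place p] (x (c (window p - d))) := by
  simp only [factor, window_sub_mul, place_sub_mul]

variable [MeasurableSpace X] {s : X → X} {c : ZMod N → κ}

theorem measurable_factor (hs : Measurable s) :
    Measurable (factor s c : ColoredOdometer X κ N M → X) :=
  measurable_from_prod_countable_left fun p =>
    (hs.iterate (place p)).comp (measurable_pi_apply (c (window p)))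

variable [Fintype κ] {μ : Measure X} [IsProbabilityMeasure μ]

theorem measureReal_pi_forall_factor_mem [DecidableEq κ] (hs : MeasurePreserving s μ μ)
    (c : ZMod N → κ) {A : Set X} (hA : MeasurableSet A) (D : Finset ℤ) (p : ZMod (N * M)) :
    (Measure.pi fun _ : κ => μ).real
        {x | ∀ d ∈ D, factor s c (x, p - ((d * M : ℤ) : ZMod (N * M))) ∈ A}
      = μ.real A ^ (D.image fun d : ℤ => c (window p - d)).card := by
  have hpi : {x : κ → X | ∀ d ∈ D, factor s c (x, p - ((d * M : ℤ) : ZMod (N * M))) ∈ A}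
      = (D.image fun d : ℤ => c (window p - d) : Set κ).pi fun _ => s^[place p] ⁻¹' A := by
    ext x
    simp only [factor_sub_mul, Finset.coe_image, Set.mem_pi, Set.forall_mem_image,
      Set.mem_preimage, Finset.mem_coe, Set.mem_ofPred_eq]
  rw [hpi, measureReal_def, Measure.pi_pi_finset, ENNReal.toReal_prod,
    (hs.iterate _).measure_preimage hA.nullMeasurableSet, Finset.prod_const, measureReal_def]

theorem measureReal_forall_factor_mem [DecidableEq κ] (hs : MeasurePreserving s μ μ)
    (c : ZMod N → κ) {A : Set X} (hA : MeasurableSet A) (D : Finset ℤ) :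
    (measure μ κ N M).real {y | ∀ d ∈ D, factor s c (y.1, y.2 - ((d * M : ℤ) : ZMod (N * M))) ∈ A}
      = (∑ t : ZMod N, μ.real A ^ (D.image fun d : ℤ => c (t - d)).card) / N := by
  have hE : MeasurableSet {y : ColoredOdometer X κ N M |
      ∀ d ∈ D, factor s c (y.1, y.2 - ((d * M : ℤ) : ZMod (N * M))) ∈ A} := by
    simp only [Set.ofPred_forall]
    exact D.measurableSet_biInter fun d _ => (measurable_factor hs.measurable).comp
      (measurable_fst.prodMk ((Measurable.of_discrete (f := (· - _))).comp measurable_snd)) hA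
  rw [measureReal_eq hE]
  simp only [Set.mem_ofPred_eq, measureReal_pi_forall_factor_mem hs c hA]
  rw [sum_comp_window fun t : ZMod N => μ.real A ^ (D.image fun d : ℤ => c (t - d)).card,
    mul_comm (N : ℝ), mul_div_mul_left _ _ (NeZero.ne _)]

theorem measurePreserving_factor (hs : MeasurePreserving s μ μ) (c : ZMod N → κ) :
    MeasurePreserving (factor s c) (measure μ κ N M) μ := by
  classical
  refine ⟨measurable_factor hs.measurable, ?_⟩
  have := Measure.isProbabilityMeasure_map (μ := measure μ κ N M)
    (measurable_factor (c := c) hs.measurable).aemeasurable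
  refine Measure.ext fun A hA => (measureReal_eq_measureReal_iff).1 ?_
  rw [map_measureReal_apply (measurable_factor hs.measurable) hA]
  have hN : (N : ℝ) ≠ 0 := NeZero.ne _
  simpa [ZMod.card, Set.preimage, hN] using measureReal_forall_factor_mem (M := M) hs c hA {0}

theorem measureReal_step_symm_preimage_symmDiff_le (s : X → X) (c : ZMod N → κ) (A : Set X) :
    (measure μ κ N M).real
      (((step μ κ N M).1.symm ⁻¹' (factor s c ⁻¹' (s ⁻¹' A))) ∆ (factor s c ⁻¹' A)) ≤ 1 / M := by
  rw [← measureReal_place_eq_zero (μ := μ) (κ := κ) (N := N)]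
  refine measureReal_mono fun ⟨x, p⟩ hxp => ?_
  by_contra hp
  obtain ⟨q, rfl⟩ : ∃ q, p = q + 1 := ⟨p - 1, (sub_add_cancel p 1).symm⟩
  have hstep : (step μ κ N M).1.symm (x, q + 1) = (x, q) := by
    rw [← zpow_one (step μ κ N M), step_zpow_symm_apply, Int.cast_one, add_sub_cancel_right]
  rw [Set.mem_symmDiff, Set.mem_preimage, hstep] at hxp
  simp only [Set.mem_preimage, factor_add_one s c x hp, and_not_self, or_self] at hxp

theorem measureReal_inter_inter_step_zpow [DecidableEq κ] (hs : MeasurePreserving s μ μ)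
    (c : ZMod N → κ) {A : Set X} (hA : MeasurableSet A) (a b : ℤ) :
    (measure μ κ N M).real (factor s c ⁻¹' A ∩
        (step μ κ N M ^ (a * M)).1.symm ⁻¹' (factor s c ⁻¹' A) ∩
        (step μ κ N M ^ (b * M)).1.symm ⁻¹' (factor s c ⁻¹' A))
      = (∑ t, μ.real A ^ ({c t, c (t - a), c (t - b)} : Finset κ).card) / N := by
  have hinter : factor s c ⁻¹' A ∩
      (step μ κ N M ^ (a * M)).1.symm ⁻¹' (factor s c ⁻¹' A) ∩
      (step μ κ N M ^ (b * M)).1.symm ⁻¹' (factor s c ⁻¹' A)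
        = {y | ∀ d ∈ ({0, a, b} : Finset ℤ),
            factor s c (y.1, y.2 - ((d * M : ℤ) : ZMod (N * M))) ∈ A} := by
    ext y
    simp only [Set.mem_inter_iff, Set.mem_preimage, step_zpow_symm_apply, Set.mem_ofPred_eq,
      Finset.forall_mem_insert, Finset.mem_singleton, forall_eq, zero_mul, Int.cast_zero, sub_zero,
      and_assoc]
  rw [hinter, measureReal_forall_factor_mem hs c hA]
  simp [Finset.image_insert]

end Factor

end ColoredOdometer

namespace MeasureAut

section Transport

variable {X Y : Type*} [MeasurableSpace X] [MeasurableSpace Y] {μ : Measure X} {ν : Measure Y}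

/-- The homomorphism between the groups of measure preserving transformations of two isomorphic
spaces. -/
def mpGroupCongr (θ : X ≃ᵐ Y) (hθ : MeasurePreserving θ μ ν) : mpGroup ν →* mpGroup μ where
  toFun Φ := ⟨θ.symm.toEquiv.permCongr Φ, (hθ.symm θ).comp (Φ.2.1.comp hθ),
    (hθ.symm θ).comp (Φ.2.2.comp hθ)⟩
  map_one' := by ext; simp
  map_mul' Φ Ψ := by ext; simp

theorem act_zpow_mk_mpGroupCongr {θ : X ≃ᵐ Y} (hθ : MeasurePreserving θ μ ν) (Φ : mpGroup ν)
    (k : ℤ) {C : MeasuredSets μ} {D : Set Y} (hDC : θ ⁻¹' D =ᵐ[μ] (C : Set X)) :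
    (act ((QuotientGroup.mk (mpGroupCongr θ hθ Φ) : MeasureAut μ) ^ k) C : Set X)
      =ᵐ[μ] θ ⁻¹' ((Φ ^ k).1.symm ⁻¹' D) := by
  rw [← QuotientGroup.mk_zpow, ← map_zpow]
  set Ψ := mpGroupCongr θ hθ (Φ ^ k)
  have hmodel : Ψ.1.symm ⁻¹' (θ ⁻¹' D) = θ ⁻¹' ((Φ ^ k).1.symm ⁻¹' D) := by
    ext x
    change θ (θ.symm ((Φ ^ k).1.symm (θ x))) ∈ D ↔ _
    rw [θ.apply_symm_apply]
    rfl
  rw [← hmodel]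
  exact (inseparable_measuredSets_iff.1 (act_mk Ψ C)).trans
    (Ψ.2.2.quasiMeasurePreserving.preimage_ae_eq hDC.symm)

theorem tripleCorr_mk_mpGroupCongr {θ : X ≃ᵐ Y} (hθ : MeasurePreserving θ μ ν) (Φ : mpGroup ν)
    (a b : ℤ) {C : MeasuredSets μ} {D : Set Y} (hDC : θ ⁻¹' D =ᵐ[μ] (C : Set X)) :
    tripleCorr (QuotientGroup.mk (mpGroupCongr θ hθ Φ)) a b C
      = ν.real (D ∩ (Φ ^ a).1.symm ⁻¹' D ∩ (Φ ^ b).1.symm ⁻¹' D) := by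
  rw [tripleCorr, measureReal_congr ((hDC.symm.inter (act_zpow_mk_mpGroupCongr hθ Φ a hDC)).inter
    (act_zpow_mk_mpGroupCongr hθ Φ b hDC)), ← Set.preimage_inter, ← Set.preimage_inter,
    measureReal_def, hθ.measure_preimage_equiv, measureReal_def]

end Transport

section Density

variable {X : Type*} [MeasurableSpace X] {μ : Measure X}

theorem preimage_act (S : MeasureAut μ) (C : MeasuredSets μ) :
    (Quotient.out S : mpGroup μ).1 ⁻¹' act S C = C := by
  rw [coe_act]
  exact Equiv.preimage_image _ _

variable [StandardBorelSpace X] [IsProbabilityMeasure μ] [NullSingletonClass μ]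

theorem exists_tripleCorr_eq_and_dist_act_le {κ : Type*} [Finite κ] [DecidableEq κ] {N : ℕ}
    [NeZero N] (c : ZMod N → κ) (M : ℕ) [NeZero M] (S : MeasureAut μ) {ι : Type*} [Finite ι]
    (C : ι → MeasuredSets μ) :
    ∃ T : MeasureAut μ, ∀ i,
      (∀ a b : ℤ, tripleCorr T (a * M) (b * M) (C i)
        = (∑ t : ZMod N, μ.real (C i) ^ ({c t, c (t - a), c (t - b)} : Finset κ).card) / N) ∧
      dist (act T (C i)) (act S (C i)) ≤ 1 / M := by
  have := Fintype.ofFinite κ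
  have : Nonempty κ := ⟨c 0⟩
  have hS := (Quotient.out S : mpGroup μ).2.1
  obtain ⟨θ, hθ, hθC⟩ := exists_measurableEquiv_preimage_ae_eq
    (ColoredOdometer.measurePreserving_factor (M := M) hS c)
    (B := Sum.elim (fun i => (C i : Set X)) fun i => (act S (C i) : Set X))
    (Sum.forall.2 ⟨fun i => (C i).2, fun i => (act S (C i)).2⟩)
  let Φ := ColoredOdometer.step μ κ N M
  refine ⟨QuotientGroup.mk (mpGroupCongr θ hθ Φ), fun i => ⟨fun a b => ?_, ?_⟩⟩
  · rw [tripleCorr_mk_mpGroupCongr hθ _ _ _ (hθC (.inl i))]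
    exact ColoredOdometer.measureReal_inter_inter_step_zpow hS c (C i).2 a b
  · have hΦC := act_zpow_mk_mpGroupCongr hθ Φ 1 (hθC (.inl i))
    have hSC : θ ⁻¹' _ =ᵐ[μ] (act S (C i) : Set X) := hθC (.inr i)
    have hle := ColoredOdometer.measureReal_step_symm_preimage_symmDiff_le (μ := μ) (M := M)
      (Quotient.out S : mpGroup μ).1 c (act S (C i))
    rw [zpow_one, zpow_one] at hΦC
    rw [preimage_act] at hle
    rwa [MeasuredSets.dist_def, measureReal_congr (hΦC.symmDiff hSC.symm),
      ← Set.preimage_symmDiff, measureReal_def, hθ.measure_preimage_equiv, ← measureReal_def]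

/-- The colours of the twelve windows of the odometer with asymmetric triple correlations: the
windows `t`, `t - 1`, `t - 5` have one colour in common if `3 ∣ t` and three different colours
otherwise, whereas the windows `t`, `t + 1`, `t + 5` always have exactly two colours. -/
def windowColor : ZMod 12 → Fin 4 := ![0, 2, 1, 1, 3, 2, 2, 0, 3, 3, 1, 0]

theorem sum_pow_card_windowColor_sub (x : ℝ) :
    (∑ t, x ^ ({windowColor t, windowColor (t - 1), windowColor (t - 5)} : Finset (Fin 4)).card)
      / 12 = (x + 2 * x ^ 3) / 3 := by
  have hcard : ∀ t : ZMod 12, ({windowColor t, windowColor (t - 1), windowColor (t - 5)} :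
      Finset (Fin 4)).card = if 3 ∣ t.val then 1 else 3 := by decide
  have hdvd : (Finset.univ.filter fun t : ZMod 12 => 3 ∣ t.val).card = 4 := by decide
  have hndvd : (Finset.univ.filter fun t : ZMod 12 => ¬ 3 ∣ t.val).card = 8 := by decide
  simp only [hcard, apply_ite (x ^ ·), Finset.sum_ite, Finset.sum_const, hdvd, hndvd]
  ring

theorem sum_pow_card_windowColor_add (x : ℝ) :
    (∑ t, x ^ ({windowColor t, windowColor (t + 1), windowColor (t + 5)} : Finset (Fin 4)).card)
      / 12 = x ^ 2 := by
  have hcard : ∀ t : ZMod 12, ({windowColor t, windowColor (t + 1), windowColor (t + 5)} :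
      Finset (Fin 4)).card = 2 := by decide
  simp [hcard, ZMod.card]

theorem exists_tripleCorr_eq_asymmetric_and_dist_act_le (M : ℕ) [NeZero M] (S : MeasureAut μ)
    {ι : Type*} [Finite ι] (C : ι → MeasuredSets μ) :
    ∃ T : MeasureAut μ, ∀ i,
      tripleCorr T M (5 * M) (C i) = (μ.real (C i) + 2 * μ.real (C i) ^ 3) / 3 ∧
      tripleCorr T (-M) (-(5 * M)) (C i) = μ.real (C i) ^ 2 ∧
      dist (act T (C i)) (act S (C i)) ≤ 1 / M := by
  obtain ⟨T, hT⟩ := exists_tripleCorr_eq_and_dist_act_le windowColor M S C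
  refine ⟨T, fun i => ⟨?_, ?_, (hT i).2⟩⟩
  · have h := (hT i).1 1 5
    rw [one_mul] at h
    simpa [sum_pow_card_windowColor_sub] using h
  · have h := (hT i).1 (-1) (-5)
    rw [neg_mul, neg_mul, one_mul] at h
    simpa [sum_pow_card_windowColor_add] using h

theorem dense_approxLimits {B : ℕ → MeasuredSets μ} (hB : DenseRange B) (k : ℕ) :
    letI := halmosPseudoMetric μ fun i => (B i : Set X)
    Dense (approxLimits B k) := by
  let := halmosPseudoMetric μ fun i => (B i : Set X)
  intro S
  choose u hu using fun n : ℕ =>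
    exists_tripleCorr_eq_asymmetric_and_dist_act_le (n + k + 2) S fun i : Fin n => B i
  have hact : Equicontinuous fun n => act (u n) :=
    (LipschitzWith.uniformEquicontinuous _ 1 fun n => (isometry_act (u n)).lipschitz).equicontinuous
  have hlim : Tendsto u atTop (𝓝 S) := (tendsto_halmos_iff hB).2 <|
    tendsto_of_dist_lt_of_denseRange hact (isometry_act S).continuous hB fun n i hi =>
      (hu n ⟨i, hi⟩).2.2.trans_lt <|
        one_div_lt_one_div_of_lt (by positivity) (by push_cast; linarith [k.cast_nonneg (α := ℝ)])
  refine mem_closure_of_tendsto hlim ?_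
  filter_upwards [eventually_ge_atTop k] with n hn
  refine ⟨n + k + 2, by omega, 5 * (n + k + 2), by omega, fun i hi => ?_⟩
  obtain ⟨hpos, hneg, -⟩ := hu n ⟨i, hi.trans_le hn⟩
  push_cast at hpos hneg ⊢
  rw [hpos, hneg, dist_self, dist_self]
  exact ⟨by positivity, by positivity⟩

end Density

end MeasureAut

theorem mainTheorem7 {X : Type*} [MeasurableSpace X] [StandardBorelSpace X]
    (μ : Measure X) [IsProbabilityMeasure μ] [NullSingletonClass μ] :
    (∀ T : MeasureAut μ, T.HasAsymmetricLimits → T.IsAsymmetric) ∧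
      ∀ A : ℕ → Set X, IsDenseSetSeq μ A →
        MeasureAut.IsTypical A {T : MeasureAut μ | T.HasAsymmetricLimits} := by
  refine ⟨fun T hT => hT.isAsymmetric, fun A hA => ?_⟩
  obtain ⟨B, hB, rfl⟩ := hA.exists_denseRange
  let := MeasureAut.halmosPseudoMetric μ fun i => (B i : Set X)
  have : CompleteSpace (MeasureAut μ) := MeasureAut.completeSpace_halmos hB
  have hopen := MeasureAut.isOpen_approxLimits hB
  exact ⟨⋂ k, MeasureAut.approxLimits B k, IsGδ.iInter_of_isOpen hopen,
    dense_iInter_of_isOpen hopen (MeasureAut.dense_approxLimits hB), fun T hT =>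
      MeasureAut.hasAsymmetricLimits_of_forall_mem_approxLimits hB (Set.mem_iInter.1 hT)⟩
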